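/- Let $G=(V,E)$ be a finite directed acyclic multigraph with nodes $V$, channels $E$ and a single source $s$; let $T=\{t_1,\dots,t_l\}$ be a set of $l\ge 1$ sink nodes and let $\mathcal F$ be a finite field. The source emits $w$ symbols of $\mathcal F$, regarded as arriving at $s$ on $w$ imaginary channels whose global encoding kernels are the standard basis vectors of $\mathcal F^w$. Each channel $e\in E$ has the global encoding kernel $f_e=\sum_{d\in In(tail(e))}k_{d,e}f_d\in\mathcal F^w$, where the local encoding coefficients $k_{d,e}$ (one for each pair consisting of a channel $d$, possibly imaginary, and a channel $e\in E$ leaving the node that $d$ enters) are independent random variables uniformly distributed on $\mathcal F$. For $t\in T$ let $F_t=(f_e: e\in In(t))$, and let $$P_e=\Pr\big(\exists\, t\in T:\ \operatorname{Rank}(F_t)<w\big),\qquad a=1-\prod_{h=1}^{w}\Big(1-\frac1{|\mathcal F|^h}\Big).$$ For each $i$ choose $w$ pairwise channel-disjoint paths from $s$ to $t_i$ (assumed to exist), and let $r_i$ be the number of distinct internal nodes on these paths (nodes on them other than $s$ and $t_i$). Suppose $\sum_{i=1}^l r_i\le n$, and write $n=l\hat b+\hat u$ with integers $\hat b\ge0$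 and $0\le\hat u\le l-1$. If $\hat b\ge1$, suppose also that $la\le 1$. Then $$P_e\le 1-(1-a)^l(1-la)^{\hat b}(1-\hat u a).$$ -/

import Mathlib

open MeasureTheory ProbabilityTheory

/-- A single-source communication network: a directed acyclic multigraph with node type `V` and
channel type `E` (parallel channels are allowed), together with its source node. -/
structure Network (V E : Type*) where
  tail : E → V
  head : E → V
  source : V
  acyclic : ∀ v, ¬ Relation.TransGen (fun i j => ∃ e, tail e = i ∧ head e = j) v v

namespace Network

variable {V E F Ω : Type*}

/-- Channel `d` is directly followed by channel `e`. -/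
def Follows (N : Network V E) (d e : E) : Prop := N.head d = N.tail e

theorem wellFounded_follows [Finite E] (N : Network V E) : WellFounded N.Follows := by
  have key : ∀ e, ¬ Relation.TransGen N.Follows e e := fun e h =>
    N.acyclic (N.tail e) (h.lift N.tail
      (fun d _ hd => ⟨d, rfl, hd⟩))
  have : Std.Irrefl (Relation.TransGen N.Follows) := ⟨key⟩
  exact Subrelation.wf (fun h => Relation.TransGen.single h)
    (Finite.wellFounded_of_trans_of_irrefl (Relation.TransGen N.Follows))

/-- The heads of the channels, where the network is extended by `w` imaginary channels
(`Sum.inl i`, `i : Fin w`) entering the source. -/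
def extHead (N : Network V E) (w : ℕ) : Fin w ⊕ E → V :=
  Sum.elim (fun _ => N.source) N.head

/-- The adjacent pairs of channels `(d, e)`, where `d` may be an imaginary channel and `e` is an
outgoing channel of the node that `d` enters. These index the local encoding coefficients. -/
abbrev AdjPair (N : Network V E) (w : ℕ) : Type _ :=
  {p : (Fin w ⊕ E) × E // N.extHead w p.1 = N.tail p.2}

/-- The global encoding kernels determined by the local encoding coefficients `k`:
`f_e = ∑ d ∈ In(tail e), k_{d,e} f_d`, where the kernels of the `w` imaginary
channels entering the source are the standard basis vectors. -/
noncomputable def globalKernel [DecidableEq V] [Fintype E] [Field F] (N : Network V E) (w : ℕ)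
    (k : N.AdjPair w → F) : E → Fin w → F :=
  N.wellFounded_follows.fix fun e f =>
    ∑ d : {d : Fin w ⊕ E // N.extHead w d = N.tail e},
      k ⟨(d.1, e), d.2⟩ •
        (match d with
          | ⟨Sum.inl i, _⟩ => Pi.single i 1
          | ⟨Sum.inr d', h⟩ => f d' h)

theorem globalKernel_eq [DecidableEq V] [Fintype E] [Field F] (N : Network V E) (w : ℕ)
    (k : N.AdjPair w → F) (e : E) :
    N.globalKernel w k e = ∑ d : {d : Fin w ⊕ E // N.extHead w d = N.tail e},
      k ⟨(d.1, e), d.2⟩ •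
        Sum.elim (fun i => Pi.single i 1) (N.globalKernel w k) d.1 := by
  unfold globalKernel
  rw [WellFounded.fix_eq]
  refine Finset.sum_congr rfl ?_
  rintro ⟨i | d, h⟩ _ <;> rfl

/-- The decoding matrix `F_t` at the node `t`: its columns are the global encoding kernels of the
incoming channels of `t`. -/
noncomputable def decodingMatrix [DecidableEq V] [Fintype E] [Field F] (N : Network V E) (w : ℕ)
    (k : N.AdjPair w → F) (t : V) : Matrix (Fin w) {e : E // N.head e = t} F :=
  Matrix.of fun i e => N.globalKernel w k e.1 i

/-- The failure probability for the sink set `T`: the probability that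
the decoding matrix of at least one sink has rank less than `w`, for random local
encoding coefficients `k`. -/
noncomputable def failureProb [DecidableEq V] [Fintype E] [Field F] [MeasurableSpace Ω]
    (N : Network V E) (w : ℕ) (T : Finset V) (μ : Measure Ω) (k : N.AdjPair w → Ω → F) : ℝ :=
  μ.real {ω | ∃ t ∈ T, (N.decodingMatrix w (fun p => k p ω) t).rank < w}

/-- The list of channels `p` is a (nonempty) directed path from the source to `t`. -/
structure IsSourcePath (N : Network V E) (t : V) (p : List E) : Prop where
  first : p.head?.map N.tail = some N.source
  last : p.getLast?.map N.head = some t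
  chain : p.IsChain N.Follows

/-- `P` is a family of `w` pairwise channel-disjoint directed paths from the source to `t`. -/
structure IsDisjointPaths (N : Network V E) {w : ℕ} (t : V) (P : Fin w → List E) : Prop where
  path : ∀ j, N.IsSourcePath t (P j)
  disjoint : ∀ i j, i ≠ j → (P i).Disjoint (P j)

/-- The number of distinct internal nodes on the paths `P` from the source to `t`, that is, of the
nodes on these paths other than their end points. -/
noncomputable def numInternal (N : Network V E) {w : ℕ} (t : V) (P : Fin w → List E) : ℕ :=
  {v : V | v ≠ N.source ∧ v ≠ t ∧ ∃ j, ∃ e ∈ P j, N.tail e = v ∨ N.head e = v}.ncard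

end Network

/-- `a = 1 - ∏_{h=1}^{w} (1 - 1 / q^h)`. -/
noncomputable def singularProb (q w : ℕ) : ℝ :=
  1 - ∏ h ∈ Finset.Icc 1 w, (1 - 1 / (q : ℝ) ^ h)

/-! Process the nodes in topological order and let `Z` be the set of nodes processed so far, closed
under predecessors. On each of the `w` paths to a sink `t`, prefixed by an imaginary channel, the
frontier channel is the first one whose head is outside `Z`, or else the last channel. For empty `Z`
the frontier kernels are the standard basis. When `Z` contains all nodes they are columns of `F_t`,
so their independence gives rank `w` (`FrontierIndep.le_rank`).

Processing `v` redraws only the coefficients of channels leaving `v`. The frontier of `t` stays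
independent if the coefficient vectors of its new channels are independent modulo a subspace whose
codimension is at least their number (`FrontierIndep.insert_resample`,
`FrontierIndep.card_newChannels_le`); uniform vectors achieve this with probability at least `1 -
a`.

To combine the sinks, choose for each `t` a topologically last tail `z t` of its paths, so that path
channels leaving it enter `t`. At `v`, the sinks with `z t = v` have disjoint sets of new channels
and jointly succeed with probability at least `(1 - a) ^ |S v|`. The other sinks using `v`, forming
`R v`, are handled by a union bound conditional on that success, giving the factor `1 - |R v| a`.
This needs positive correlation (`one_sub_singularProb_mul_countReal_le`), which comes from `|A| |B|
= |A + B| |A ∩ B|` for finite subspaces.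

Multiplying over all nodes gives `(1 - a) ^ l * ∏ (1 - |R v| a)`. The tails for `t` other than `z t`
number at most `r_t`, so `∑ |R v| ≤ n`, and `|R v| ≤ l`. Under these constraints the product is
smallest when as many factors as possible are `1 - l a` (`greedyProd_sum_le_prod`). -/

open Classical in
/-- The number of elements of a finite type with a given property, as a real number. -/
noncomputable def countReal {X : Type*} [Fintype X] (p : X → Prop) : ℝ :=
  ((Finset.univ.filter p).card : ℝ)

/-! ### Counting on finite types and resampling one component -/

section Counting

variable {X Y : Type*} [Fintype X] [Fintype Y]

open Classical in
theorem countReal_eq_sum (p : X → Prop) : countReal p = ∑ x, if p x then (1 : ℝ) else 0 := by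
  simp [countReal]

theorem countReal_nonneg (p : X → Prop) : 0 ≤ countReal p := Nat.cast_nonneg _

theorem countReal_mono {p p' : X → Prop} (h : ∀ x, p x → p' x) : countReal p ≤ countReal p' := by
  classical
  simp only [countReal_eq_sum]
  refine Finset.sum_le_sum fun x _ => ?_
  by_cases hp : p x
  · simp [hp, h x hp]
  · simp only [hp, if_false]
    split_ifs <;> norm_num

theorem countReal_congr {p p' : X → Prop} (h : ∀ x, p x ↔ p' x) : countReal p = countReal p' := by
  rw [show p = p' from funext fun x => propext (h x)]

theorem countReal_true : countReal (fun _ : X => True) = Fintype.card X := by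
  simp [countReal]

theorem countReal_not (p : X → Prop) :
    countReal (fun x => ¬ p x) = Fintype.card X - countReal p := by
  classical
  simp only [countReal_eq_sum]
  rw [eq_sub_iff_add_eq, ← Finset.sum_add_distrib]
  rw [Finset.sum_congr rfl (g := fun _ => (1 : ℝ))]
  · simp
  · intro x _
    by_cases h : p x <;> simp [h]

theorem countReal_and_not (p p' : X → Prop) :
    countReal (fun x => p x ∧ ¬ p' x) = countReal p - countReal (fun x => p x ∧ p' x) := by
  classical
  simp only [countReal_eq_sum]
  rw [← Finset.sum_sub_distrib]
  refine Finset.sum_congr rfl fun x _ => ?_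
  by_cases h : p x <;> by_cases h' : p' x <;> simp [h, h']

theorem countReal_exists_le {ι : Type*} (s : Finset ι) (p : ι → X → Prop) :
    countReal (fun x => ∃ i ∈ s, p i x) ≤ ∑ i ∈ s, countReal (p i) := by
  classical
  simp only [countReal_eq_sum]
  rw [Finset.sum_comm]
  refine Finset.sum_le_sum fun x _ => ?_
  split_ifs with h
  · obtain ⟨i, hi, hp⟩ := h
    refine le_trans ?_ (Finset.single_le_sum (f := fun i => if p i x then (1 : ℝ) else 0)
      (fun i _ => by split_ifs <;> norm_num) hi)
    simp [hp]
  · exact Finset.sum_nonneg fun i _ => by split_ifs <;> norm_num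

/-- Resampling one component of a uniformly distributed element: if `ov x y` replaces the
component `ex x` of `x` by `y`, then the counts are preserved. -/
theorem card_mul_countReal_eq_sum_resample (ov : X → Y → X) (ex : X → Y)
    (h₁ : ∀ x y, ex (ov x y) = y) (h₂ : ∀ x y, ov (ov x y) (ex x) = x) (p : X → Prop) :
    (Fintype.card Y : ℝ) * countReal p = ∑ x, countReal (fun y => p (ov x y)) := by
  classical
  simp only [countReal_eq_sum]
  -- `σ` swaps the stored component with the fresh one; `h₁` and `h₂` make it an involution.
  let σ : X × Y ≃ X × Y :=
    ⟨fun z => (ov z.1 z.2, ex z.1), fun z => (ov z.1 z.2, ex z.1),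
      fun z => by simp [h₁, h₂], fun z => by simp [h₁, h₂]⟩
  rw [← Fintype.sum_prod_type' (f := fun x y => if p (ov x y) then (1 : ℝ) else 0)]
  rw [← Equiv.sum_comp σ]
  simp only [σ, Equiv.coe_fn_mk, h₂]
  rw [Fintype.sum_prod_type' (f := fun x _ => if p x then (1 : ℝ) else 0)]
  rw [Finset.mul_sum]
  refine Finset.sum_congr rfl fun x _ => ?_
  rw [Finset.sum_const, Finset.card_univ, nsmul_eq_mul]

theorem sum_countReal_and_eq (p : X → Prop) (r : X → Y → Prop) (c : ℝ)
    (h : ∀ x, p x → countReal (r x) = c) :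
    ∑ x, countReal (fun y => p x ∧ r x y) = c * countReal p := by
  classical
  rw [countReal_eq_sum, Finset.mul_sum]
  refine Finset.sum_congr rfl fun x _ => ?_
  by_cases hp : p x
  · simp [hp, h x hp]
  · simp [hp, countReal]

theorem le_sum_countReal_and (p : X → Prop) (r : X → Y → Prop) (c : ℝ)
    (h : ∀ x, p x → c ≤ countReal (r x)) :
    c * countReal p ≤ ∑ x, countReal (fun y => p x ∧ r x y) := by
  classical
  rw [countReal_eq_sum, Finset.mul_sum]
  refine Finset.sum_le_sum fun x _ => ?_
  by_cases hp : p x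
  · simp [hp, h x hp]
  · simp [hp, countReal]

end Counting

/-! ### Sizes of subspaces and correlation of their complements -/

section Subspaces

variable {F K : Type*} [Field F] [Fintype F] [AddCommGroup K] [Module F K] [Fintype K]

theorem countReal_mem_submodule (A : Submodule F K) :
    countReal (fun y => y ∈ A) = (Fintype.card F : ℝ) ^ Module.finrank F A := by
  classical
  rw [countReal, ← Fintype.card_subtype, ← Nat.cast_pow]
  congr 1
  exact Module.card_eq_pow_finrank

/-- Since `|A| |B| = |A + B| |A ∩ B| ≤ |K| |A ∩ B|`, membership in two subspaces is positively
correlated, and positive correlation passes to complements. All correlation in the proof originates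
here. -/
theorem countReal_notMem_mul_le (A B : Submodule F K) :
    countReal (fun y => y ∉ A) * countReal (fun y => y ∉ B) ≤
      Fintype.card K * countReal (fun y => y ∉ A ∧ y ∉ B) := by
  have hinf : countReal (fun y => y ∈ A ∧ y ∈ B) = countReal (fun y => y ∈ A ⊓ B) := rfl
  have key : countReal (fun y => y ∈ A) * countReal (fun y => y ∈ B) ≤
      Fintype.card K * countReal (fun y => y ∈ A ∧ y ∈ B) := by
    rw [hinf, countReal_mem_submodule, countReal_mem_submodule, ← pow_add,
      ← Submodule.finrank_sup_add_finrank_inf_eq, pow_add, ← countReal_mem_submodule,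
      ← countReal_mem_submodule]
    refine mul_le_mul_of_nonneg_right ?_ (countReal_nonneg _)
    rw [← countReal_true]
    exact countReal_mono fun _ _ => trivial
  have h1 : countReal (fun y => y ∉ A ∧ y ∉ B) =
      countReal (fun y => y ∉ A) - (countReal (fun y => y ∈ B) -
        countReal (fun y => y ∈ A ∧ y ∈ B)) := by
    rw [countReal_and_not]
    congr 1
    rw [countReal_congr (p' := fun y => y ∈ B ∧ ¬ y ∈ A) (fun y => and_comm), countReal_and_not]
    congr 1
    exact countReal_congr fun y => and_comm
  rw [h1, countReal_not, countReal_not]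
  nlinarith

end Subspaces

/-! ### Linear independence modulo a subspace -/

section IndependentModulo

variable {F K O : Type*} [Field F] [AddCommGroup K] [Module F K]

/-- The vectors `κ e`, `e ∈ s`, are linearly independent modulo the subspace `W`. -/
def IndepMod (W : Submodule F K) (κ : O → K) (s : Finset O) : Prop :=
  LinearIndepOn F (W.mkQ ∘ κ) (s : Set O)

theorem IndepMod.congr {W : Submodule F K} {κ κ' : O → K} {s : Finset O}
    (h : ∀ e ∈ s, κ e = κ' e) : IndepMod W κ s ↔ IndepMod W κ' s :=
  linearIndepOn_congr fun e he => by simp [h e he]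

theorem indepMod_insert [DecidableEq O] {W : Submodule F K} {κ : O → K} {s : Finset O} {e : O}
    (he : e ∉ s) :
    IndepMod W κ (insert e s) ↔
      IndepMod W κ s ∧ κ e ∉ W ⊔ Submodule.span F (κ '' (s : Set O)) := by
  unfold IndepMod
  rw [Finset.coe_insert, linearIndepOn_insert (by simpa using he), ← Submodule.comap_map_mkQ,
    Submodule.mem_comap, Submodule.map_span, Set.image_comp]
  rfl

theorem IndepMod.finrank_quotient_add_card [FiniteDimensional F K] {W : Submodule F K} {κ : O → K}
    {s : Finset O} (h : IndepMod W κ s) :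
    Module.finrank F (K ⧸ (W ⊔ Submodule.span F (κ '' (s : Set O)))) + s.card =
      Module.finrank F (K ⧸ W) := by
  set B := W ⊔ Submodule.span F (κ '' (s : Set O)) with hB
  have e := (Submodule.quotientQuotientEquivQuotient W B le_sup_left).finrank_eq
  have hmap : B.map W.mkQ = Submodule.span F (Set.range fun e : (s : Set O) => W.mkQ (κ e)) := by
    rw [hB, Submodule.map_sup, Submodule.map_span, ← Set.image_comp, Submodule.mkQ_map_self,
      bot_sup_eq, Set.image_eq_range]
    rfl
  have hc : Module.finrank F (B.map W.mkQ) = s.card := by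
    rw [hmap, finrank_span_eq_card (b := fun e : (s : Set O) => W.mkQ (κ e)) h]
    simp
  rw [← e, ← hc]
  exact Submodule.finrank_quotient_add_finrank _

/-- The count depends on `κ` only through independence, not on the actual vectors. The natural
subtraction is not truncated, by `IndepMod.finrank_quotient_add_card`. -/
theorem IndepMod.countReal_mem [Fintype F] [Fintype K] {W : Submodule F K} {κ : O → K}
    {s : Finset O} (h : IndepMod W κ s) :
    countReal (fun y => y ∈ W ⊔ Submodule.span F (κ '' (s : Set O))) =
      (Fintype.card K : ℝ) * (1 / (Fintype.card F : ℝ)) ^ (Module.finrank F (K ⧸ W) - s.card) := by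
  have h1 := h.finrank_quotient_add_card
  have h2 := Submodule.finrank_quotient_add_finrank
    (W ⊔ Submodule.span F (κ '' (s : Set O)))
  have hq : (Fintype.card F : ℝ) ≠ 0 := by
    exact_mod_cast Fintype.card_ne_zero
  rw [countReal_mem_submodule, Module.card_eq_pow_finrank (K := F) (V := K), ← h2, ← h1,
    Nat.add_sub_cancel, Nat.cast_pow, pow_add, one_div, inv_pow]
  field_simp

end IndependentModulo

/-! ### Random coefficient vectors at a single node -/

section NodeStep

variable {F K O ι : Type*} [Field F] [AddCommGroup K] [Module F K]

theorem indepMod_update_inter_insert [DecidableEq O] (W : Submodule F K) (κ : O → K) (y : K)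
    {s P : Finset O} {e : O} (he : e ∉ P) :
    IndepMod W (Function.update κ e y) (s ∩ insert e P) ↔
      IndepMod W κ (s ∩ P) ∧
        (e ∈ s → y ∉ W ⊔ Submodule.span F (κ '' ((s ∩ P : Finset O) : Set O))) := by
  have hne : ∀ d ∈ s ∩ P, Function.update κ e y d = κ d := fun d hd =>
    Function.update_of_ne (fun h : d = e => he (h ▸ (Finset.mem_inter.1 hd).2)) _ _
  by_cases hs : e ∈ s
  · have him : Function.update κ e y '' ((s ∩ P : Finset O) : Set O) =
        κ '' ((s ∩ P : Finset O) : Set O) := Set.image_congr fun d hd => hne d hd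
    rw [Finset.inter_insert_of_mem hs,
      indepMod_insert (fun h => he (Finset.mem_inter.1 h).2), IndepMod.congr hne, him]
    simp [hs]
  · rw [Finset.inter_insert_of_notMem hs, IndepMod.congr hne]
    simp [hs]

variable [Fintype F] [Fintype K]

theorem one_div_card_pow_le_one (F : Type*) [Field F] [Fintype F] (n : ℕ) :
    (1 / (Fintype.card F : ℝ)) ^ n ≤ 1 := by
  refine pow_le_one₀ (by positivity) ?_
  rw [div_le_one (by exact_mod_cast Fintype.card_pos)]
  exact_mod_cast Fintype.card_pos

theorem IndepMod.countReal_notMem {W : Submodule F K} {κ : O → K} {s : Finset O}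
    (h : IndepMod W κ s) :
    countReal (fun y => y ∉ W ⊔ Submodule.span F (κ '' (s : Set O))) =
      (Fintype.card K : ℝ) *
        (1 - (1 / (Fintype.card F : ℝ)) ^ (Module.finrank F (K ⧸ W) - s.card)) := by
  rw [countReal_not, h.countReal_mem]
  ring

/-- The number of admissible values of a new vector that keeps a disjointly supported family of
independence conditions does not depend on the previous vectors, and admissibility correlates
positively with the avoidance of a subspace. -/
theorem exists_countReal_extension_eq [DecidableEq O] (S : Finset ι) (W : ι → Submodule F K)
    (s : ι → Finset O) (hs : (S : Set ι).PairwiseDisjoint s) (P : Finset O) (e : O) :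
    ∃ D : ℝ, 0 ≤ D ∧ ∀ κ : O → K, (∀ i ∈ S, IndepMod (W i) κ (s i ∩ P)) →
      countReal (fun y => ∀ i ∈ S, e ∈ s i →
        y ∉ W i ⊔ Submodule.span F (κ '' ((s i ∩ P : Finset O) : Set O))) = D ∧
      ∀ B : Submodule F K, D * countReal (fun y => y ∉ B) ≤ Fintype.card K *
        countReal (fun y => (∀ i ∈ S, e ∈ s i →
          y ∉ W i ⊔ Submodule.span F (κ '' ((s i ∩ P : Finset O) : Set O))) ∧ y ∉ B) := by
  by_cases h : ∃ i ∈ S, e ∈ s i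
  · obtain ⟨i, hi, hei⟩ := h
    -- By disjointness at most one condition involves `e`, so the admissible set is the complement
    -- of a single subspace of known dimension.
    have huniq : ∀ i' ∈ S, e ∈ s i' → i' = i := fun i' hi' he' =>
      hs.elim_finset hi' hi e he' hei
    refine ⟨(Fintype.card K : ℝ) * (1 - (1 / (Fintype.card F : ℝ)) ^
      (Module.finrank F (K ⧸ W i) - (s i ∩ P).card)), ?_, fun κ hκ => ?_⟩
    · exact mul_nonneg (Nat.cast_nonneg _) (sub_nonneg.2 (one_div_card_pow_le_one F _))
    have hiff : ∀ y, (∀ i ∈ S, e ∈ s i →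
        y ∉ W i ⊔ Submodule.span F (κ '' ((s i ∩ P : Finset O) : Set O))) ↔
        y ∉ W i ⊔ Submodule.span F (κ '' ((s i ∩ P : Finset O) : Set O)) := fun y =>
      ⟨fun h => h i hi hei, fun h i' hi' he' => by rwa [huniq i' hi' he']⟩
    simp only [hiff]
    refine ⟨(hκ i hi).countReal_notMem, fun B => ?_⟩
    rw [← (hκ i hi).countReal_notMem]
    exact countReal_notMem_mul_le _ _
  · push Not at h
    refine ⟨Fintype.card K, Nat.cast_nonneg _, fun κ _ => ?_⟩
    have hiff : ∀ y, (∀ i ∈ S, e ∈ s i →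
        y ∉ W i ⊔ Submodule.span F (κ '' ((s i ∩ P : Finset O) : Set O))) ↔ True := fun y =>
      ⟨fun _ => trivial, fun _ i hi he => absurd he (h i hi)⟩
    simp only [hiff, true_and]
    exact ⟨countReal_true, fun B => le_rfl⟩

/-- The vectors are revealed one at a time. Whatever the earlier vectors are, the family over `S`
admits exactly `D` values of the next one, so its count scales by exactly `D / |K|`. The joint count
loses at most a further factor `ρ`, by correlation of subspace complements, and only when `e ∈ s'`.
-/
theorem prod_mul_countReal_indepMod_le [DecidableEq O] [Fintype O] (S : Finset ι)
    (W : ι → Submodule F K) (s : ι → Finset O) (hs : (S : Set ι).PairwiseDisjoint s)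
    (W' : Submodule F K) (s' : Finset O) (hc : s'.card ≤ Module.finrank F (K ⧸ W'))
    (P : Finset O) :
    (∏ r ∈ Finset.range (s' ∩ P).card, (1 - (1 / (Fintype.card F : ℝ)) ^ (s'.card - r))) *
        countReal (fun κ : O → K => ∀ i ∈ S, IndepMod (W i) κ (s i ∩ P)) ≤
      countReal (fun κ : O → K =>
        (∀ i ∈ S, IndepMod (W i) κ (s i ∩ P)) ∧ IndepMod W' κ (s' ∩ P)) := by
  induction P using Finset.induction_on with
  | empty => simp [IndepMod]
  | insert e P he ih =>
    obtain ⟨D, hD, hDκ⟩ := exists_countReal_extension_eq S W s hs P e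
    have hK : (0 : ℝ) < Fintype.card K := by exact_mod_cast Fintype.card_pos
    have hov : ∀ p : (O → K) → Prop, (Fintype.card K : ℝ) * countReal p =
        ∑ κ, countReal (fun y => p (Function.update κ e y)) :=
      card_mul_countReal_eq_sum_resample (fun κ y => Function.update κ e y) (fun κ => κ e)
        (by simp) (by simp)
    have hg : (Fintype.card K : ℝ) * countReal (fun κ : O → K =>
        ∀ i ∈ S, IndepMod (W i) κ (s i ∩ insert e P)) =
        D * countReal (fun κ : O → K => ∀ i ∈ S, IndepMod (W i) κ (s i ∩ P)) := by
      rw [hov, ← sum_countReal_and_eq _ _ D (fun κ hκ => (hDκ κ hκ).1)]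
      refine Finset.sum_congr rfl fun κ _ => countReal_congr fun y => ?_
      simp only [indepMod_update_inter_insert _ _ _ he]
      exact ⟨fun h => ⟨fun i hi => (h i hi).1, fun i hi => (h i hi).2⟩,
        fun h i hi => ⟨h.1 i hi, h.2 i hi⟩⟩
    -- Replacing the codimension of `W'` by the smaller number `s'.card` only lowers the factor, and
    -- frees it from `W'`.
    set ρ : ℝ := if e ∈ s' then 1 - (1 / (Fintype.card F : ℝ)) ^ (s'.card - (s' ∩ P).card) else 1
      with hρ
    have hρ0 : 0 ≤ ρ := by
      rw [hρ]
      split_ifs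
      · exact sub_nonneg.2 (one_div_card_pow_le_one F _)
      · exact zero_le_one
    have hh : D * ρ * countReal (fun κ : O → K =>
          (∀ i ∈ S, IndepMod (W i) κ (s i ∩ P)) ∧ IndepMod W' κ (s' ∩ P)) ≤
        (Fintype.card K : ℝ) * countReal (fun κ : O → K =>
        (∀ i ∈ S, IndepMod (W i) κ (s i ∩ insert e P)) ∧ IndepMod W' κ (s' ∩ insert e P)) := by
      rw [hov]
      refine le_trans (le_sum_countReal_and _ (fun κ y => (∀ i ∈ S, e ∈ s i →
          y ∉ W i ⊔ Submodule.span F (κ '' ((s i ∩ P : Finset O) : Set O))) ∧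
          (e ∈ s' → y ∉ W' ⊔ Submodule.span F (κ '' ((s' ∩ P : Finset O) : Set O)))) (D * ρ)
          fun κ hκ => ?_) ?_
      · by_cases hes : e ∈ s'
        · simp only [hes, forall_true_left]
          have h1 := (hDκ κ hκ.1).2 (W' ⊔ Submodule.span F (κ '' ((s' ∩ P : Finset O) : Set O)))
          rw [hκ.2.countReal_notMem] at h1
          have h2 : ρ ≤ 1 - (1 / (Fintype.card F : ℝ)) ^
              (Module.finrank F (K ⧸ W') - (s' ∩ P).card) := by
            rw [hρ, if_pos hes]
            refine sub_le_sub_left (pow_le_pow_of_le_one (by positivity)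
              (by simpa using one_div_card_pow_le_one F 1) (by omega)) _
          have h3 : (Fintype.card K : ℝ) * (D * ρ) ≤ Fintype.card K * countReal (fun y =>
              (∀ i ∈ S, e ∈ s i → y ∉ W i ⊔ Submodule.span F
                (κ '' ((s i ∩ P : Finset O) : Set O))) ∧
              y ∉ W' ⊔ Submodule.span F (κ '' ((s' ∩ P : Finset O) : Set O))) := by
            refine le_trans ?_ h1
            calc (Fintype.card K : ℝ) * (D * ρ) = D * (Fintype.card K * ρ) := by ring
              _ ≤ _ := by gcongr
          exact le_of_mul_le_mul_left h3 hK
        · simp only [hes, false_imp_iff, and_true]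
          rw [(hDκ κ hκ.1).1, hρ, if_neg hes, mul_one]
      · refine Finset.sum_le_sum fun κ _ => countReal_mono fun y => ?_
        simp only [indepMod_update_inter_insert _ _ _ he]
        exact fun h => ⟨fun i hi => ⟨h.1.1 i hi, h.2.1 i hi⟩, h.1.2, h.2.2⟩
    have hprod : ∏ r ∈ Finset.range (s' ∩ insert e P).card,
        (1 - (1 / (Fintype.card F : ℝ)) ^ (s'.card - r)) =
        (∏ r ∈ Finset.range (s' ∩ P).card,
          (1 - (1 / (Fintype.card F : ℝ)) ^ (s'.card - r))) * ρ := by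
      by_cases hes : e ∈ s'
      · rw [Finset.inter_insert_of_mem hes,
          Finset.card_insert_of_notMem (fun h => he (Finset.mem_inter.1 h).2),
          Finset.prod_range_succ, hρ, if_pos hes]
      · rw [Finset.inter_insert_of_notMem hes, hρ, if_neg hes, mul_one]
    refine le_of_mul_le_mul_left (le_trans ?_ hh) hK
    rw [hprod, mul_left_comm, hg]
    calc _ = D * ρ * ((∏ r ∈ Finset.range (s' ∩ P).card,
          (1 - (1 / (Fintype.card F : ℝ)) ^ (s'.card - r))) *
          countReal (fun κ : O → K => ∀ i ∈ S, IndepMod (W i) κ (s i ∩ P))) := by ring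
      _ ≤ _ := mul_le_mul_of_nonneg_left ih (mul_nonneg hD hρ0)

theorem one_sub_singularProb_nonneg (q w : ℕ) : 0 ≤ 1 - singularProb q w := by
  unfold singularProb
  rw [sub_sub_cancel]
  refine Finset.prod_nonneg fun h _ => sub_nonneg.2 ?_
  rw [← one_div_pow, one_div]
  exact pow_le_one₀ (by positivity) (Nat.cast_inv_le_one q)

theorem singularProb_nonneg (q w : ℕ) : 0 ≤ singularProb q w := by
  unfold singularProb
  refine sub_nonneg.2 (Finset.prod_le_one (fun h _ => sub_nonneg.2 ?_) (fun h _ => ?_))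
  · rw [← one_div_pow, one_div]
    exact pow_le_one₀ (by positivity) (Nat.cast_inv_le_one q)
  · exact sub_le_self _ (by positivity)

theorem one_sub_singularProb_le_prod (q : ℕ) {m w : ℕ} (h : m ≤ w) :
    1 - singularProb q w ≤ ∏ r ∈ Finset.range m, (1 - (1 / (q : ℝ)) ^ (m - r)) := by
  have hle : ∀ h : ℕ, (0 : ℝ) ≤ 1 - 1 / (q : ℝ) ^ h := fun h => by
    rw [sub_nonneg, ← one_div_pow, one_div]
    exact pow_le_one₀ (by positivity) (Nat.cast_inv_le_one q)
  have h1 : ∏ r ∈ Finset.range m, (1 - (1 / (q : ℝ)) ^ (m - r)) =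
      ∏ h ∈ Finset.Icc 1 m, (1 - 1 / (q : ℝ) ^ h) := by
    rw [← Finset.prod_range_reflect, Finset.range_eq_Ico,
      Finset.prod_Ico_eq_prod_range, ← Finset.Ico_succ_right_eq_Icc, Finset.prod_Ico_eq_prod_range]
    refine Finset.prod_congr (by simp) fun r hr => ?_
    have : r < m := by simpa using hr
    rw [one_div_pow, show m - (m - 1 - (0 + r)) = 1 + r by omega]
  unfold singularProb
  rw [sub_sub_cancel, h1]
  rw [← Finset.prod_sdiff (Finset.Icc_subset_Icc_right h)]
  exact mul_le_of_le_one_left (Finset.prod_nonneg fun i _ => hle i)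
    (Finset.prod_le_one (fun i _ => hle i) fun i _ => sub_le_self _ (by positivity))

/-- Positive correlation of one independence condition with a disjointly supported family of
independence conditions. -/
theorem one_sub_singularProb_mul_countReal_le [DecidableEq O] [Fintype O] {w : ℕ} (S : Finset ι)
    (W : ι → Submodule F K) (s : ι → Finset O) (hs : (S : Set ι).PairwiseDisjoint s)
    (W' : Submodule F K) (s' : Finset O) (hc : s'.card ≤ Module.finrank F (K ⧸ W'))
    (hw : s'.card ≤ w) :
    (1 - singularProb (Fintype.card F) w) *
        countReal (fun κ : O → K => ∀ i ∈ S, IndepMod (W i) κ (s i)) ≤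
      countReal (fun κ : O → K => (∀ i ∈ S, IndepMod (W i) κ (s i)) ∧ IndepMod W' κ s') := by
  have h := prod_mul_countReal_indepMod_le S W s hs W' s' hc Finset.univ
  simp only [Finset.inter_univ] at h
  exact le_trans (mul_le_mul_of_nonneg_right (one_sub_singularProb_le_prod _ hw)
    (countReal_nonneg _)) h

theorem pow_one_sub_singularProb_mul_card_le [DecidableEq O] [Fintype O] {w : ℕ} (S : Finset ι)
    (W : ι → Submodule F K) (s : ι → Finset O) (hs : (S : Set ι).PairwiseDisjoint s)
    (hc : ∀ i ∈ S, (s i).card ≤ Module.finrank F (K ⧸ W i)) (hw : ∀ i ∈ S, (s i).card ≤ w) :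
    (1 - singularProb (Fintype.card F) w) ^ S.card * Fintype.card (O → K) ≤
      countReal (fun κ : O → K => ∀ i ∈ S, IndepMod (W i) κ (s i)) := by
  classical
  induction S using Finset.induction_on with
  | empty => simp [countReal]
  | insert j S hj ih =>
    have h1 := ih (hs.subset (by simp)) (fun i hi => hc i (Finset.mem_insert_of_mem hi))
      (fun i hi => hw i (Finset.mem_insert_of_mem hi))
    have h2 := one_sub_singularProb_mul_countReal_le (w := w) S W s (hs.subset (by simp)) (W j)
      (s j) (hc j (Finset.mem_insert_self _ _)) (hw j (Finset.mem_insert_self _ _))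
    rw [Finset.card_insert_of_notMem hj, pow_succ']
    calc _ = (1 - singularProb (Fintype.card F) w) *
          ((1 - singularProb (Fintype.card F) w) ^ S.card * Fintype.card (O → K)) := by ring
      _ ≤ _ := mul_le_mul_of_nonneg_left h1 (one_sub_singularProb_nonneg _ _)
      _ ≤ _ := h2
      _ = _ := countReal_congr fun κ => by
        rw [Finset.forall_mem_insert, and_comm]

/-- Inside the event for `S`, each condition of `R` fails on at most a fraction `a`, by positive
correlation, so a union bound over `R` suffices. The sets of `R` may overlap each other and those of
`S`. -/
theorem card_mul_le_countReal_indepMod [DecidableEq O] [Fintype O] [DecidableEq ι] {w : ℕ} (S R : Finset ι)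
    (W : ι → Submodule F K) (s : ι → Finset O) (hs : (S : Set ι).PairwiseDisjoint s)
    (hc : ∀ i ∈ S ∪ R, (s i).card ≤ Module.finrank F (K ⧸ W i))
    (hw : ∀ i ∈ S ∪ R, (s i).card ≤ w)
    (hR : (R.card : ℝ) * singularProb (Fintype.card F) w ≤ 1) :
    (1 - singularProb (Fintype.card F) w) ^ S.card *
        (1 - R.card * singularProb (Fintype.card F) w) * Fintype.card (O → K) ≤
      countReal (fun κ : O → K => (∀ i ∈ S, IndepMod (W i) κ (s i)) ∧
        ∀ i ∈ R, IndepMod (W i) κ (s i)) := by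
  have h1 := pow_one_sub_singularProb_mul_card_le S W s hs
    (fun i hi => hc i (Finset.mem_union_left _ hi)) (fun i hi => hw i (Finset.mem_union_left _ hi))
  set a := singularProb (Fintype.card F) w
  set g := countReal (fun κ : O → K => ∀ i ∈ S, IndepMod (W i) κ (s i)) with hg
  have h2 : ∀ j ∈ R, countReal (fun κ : O → K => (∀ i ∈ S, IndepMod (W i) κ (s i)) ∧
      ¬ IndepMod (W j) κ (s j)) ≤ a * g := fun j hj => by
    have := one_sub_singularProb_mul_countReal_le (w := w) S W s hs (W j) (s j)
      (hc j (Finset.mem_union_right _ hj)) (hw j (Finset.mem_union_right _ hj))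
    rw [countReal_and_not]
    linarith
  have h3 : countReal (fun κ : O → K => (∀ i ∈ S, IndepMod (W i) κ (s i)) ∧
      ¬ ∀ i ∈ R, IndepMod (W i) κ (s i)) ≤ R.card * (a * g) := by
    rw [← nsmul_eq_mul, ← Finset.sum_const]
    refine le_trans ?_ (Finset.sum_le_sum h2)
    refine le_trans (countReal_mono fun κ => ?_) (countReal_exists_le _ _)
    rintro ⟨h, h'⟩
    push Not at h'
    obtain ⟨i, hi, hn⟩ := h'
    exact ⟨i, hi, h, hn⟩
  rw [countReal_and_not] at h3
  calc _ = (1 - R.card * a) * ((1 - a) ^ S.card * Fintype.card (O → K)) := by ring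
    _ ≤ (1 - R.card * a) * g := mul_le_mul_of_nonneg_left h1 (by linarith)
    _ ≤ _ := by linarith

end NodeStep

/-! ### Minimizing products of factors `1 - x a` -/

section Majorization

theorem one_sub_sum_mul_le_prod {ι : Type*} {a : ℝ} (ha : 0 ≤ a) (s : Finset ι) (x : ι → ℕ)
    (h : (∑ v ∈ s, x v : ℕ) * a ≤ 1) :
    1 - (∑ v ∈ s, x v : ℕ) * a ≤ ∏ v ∈ s, (1 - x v * a) := by
  classical
  induction s using Finset.induction_on with
  | empty => simp
  | insert v s hv ih =>
    rw [Finset.sum_insert hv, Nat.cast_add] at h ⊢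
    rw [Finset.prod_insert hv]
    have h1 : 0 ≤ (x v : ℝ) * a := by positivity
    have h2 : 0 ≤ ((∑ v ∈ s, x v : ℕ) : ℝ) * a := by positivity
    have h3 := mul_le_mul_of_nonneg_left (ih (by linarith)) (a := 1 - x v * a) (by linarith)
    nlinarith

/-- The extremal value of a product of factors `1 - x a` with `x ≤ l` and prescribed sum. -/
noncomputable def greedyProd (l : ℕ) (a : ℝ) (m : ℕ) : ℝ :=
  (1 - l * a) ^ (m / l) * (1 - (m % l : ℕ) * a)

variable {l : ℕ} {a : ℝ}

theorem greedyProd_mul_add (b : ℕ) {u : ℕ} (hu : u < l) :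
    greedyProd l a (l * b + u) = (1 - l * a) ^ b * (1 - u * a) := by
  unfold greedyProd
  rw [Nat.mul_add_div (by omega), Nat.div_eq_of_lt hu, Nat.mul_add_mod, Nat.mod_eq_of_lt hu,
    add_zero]

theorem greedyProd_nonneg (hl : 0 < l) (ha : 0 ≤ a) (hla : l * a ≤ 1) (m : ℕ) :
    0 ≤ greedyProd l a m := by
  have : ((m % l : ℕ) : ℝ) * a ≤ l * a :=
    mul_le_mul_of_nonneg_right (by exact_mod_cast (Nat.mod_lt m hl).le) ha
  exact mul_nonneg (pow_nonneg (by linarith) _) (by linarith)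

/-- Merging `x` with the remainder `u` of `m`, and splitting off a full block `l` on overflow, makes
the two sizes more unequal at constant sum, which lowers the product. -/
theorem greedyProd_add_le (hl : 0 < l) (hla : l * a ≤ 1) (m : ℕ) {x : ℕ}
    (hx : x ≤ l) : greedyProd l a (m + x) ≤ (1 - x * a) * greedyProd l a m := by
  obtain ⟨b, u, hu, rfl⟩ : ∃ b u, u < l ∧ m = l * b + u :=
    ⟨m / l, m % l, Nat.mod_lt _ hl, (Nat.div_add_mod m l).symm⟩
  have hp : 0 ≤ (1 - l * a) ^ b := pow_nonneg (by linarith) _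
  rw [greedyProd_mul_add b hu, mul_left_comm]
  by_cases h : u + x < l
  · rw [add_assoc, greedyProd_mul_add b h]
    refine mul_le_mul_of_nonneg_left ?_ hp
    have : (0 : ℝ) ≤ x * u * a ^ 2 := by positivity
    push_cast
    nlinarith
  -- Here `u + x = l + y`. With `l = x + z` and `u = z + y` the linear terms cancel, and the `a ^ 2`
  -- coefficients differ by `u x - l y = z (x - y) ≥ 0`.
  · obtain ⟨y, hy⟩ := Nat.exists_eq_add_of_le (not_lt.1 h)
    obtain ⟨z, rfl⟩ := Nat.exists_eq_add_of_le hx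
    have hyl : y < x + z := by omega
    rw [add_assoc, hy, ← add_assoc, ← Nat.mul_succ, greedyProd_mul_add _ hyl, pow_succ, mul_assoc]
    refine mul_le_mul_of_nonneg_left ?_ hp
    have hu' : (u : ℝ) = z + y := by
      have : u = z + y := by omega
      exact_mod_cast this
    have hz : (0 : ℝ) ≤ z * (x - y) := by
      refine mul_nonneg (by positivity) ?_
      have : y ≤ x := by omega
      rw [sub_nonneg]
      exact_mod_cast this
    rw [hu']
    push_cast
    nlinarith [mul_nonneg hz (sq_nonneg a)]

theorem greedyProd_antitone (hl : 0 < l) (ha : 0 ≤ a) (hla : l * a ≤ 1) :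
    Antitone (greedyProd l a) := by
  refine antitone_nat_of_succ_le fun m => ?_
  refine (greedyProd_add_le hl hla m (x := 1) hl).trans ?_
  exact mul_le_of_le_one_left (greedyProd_nonneg hl ha hla m) (by simpa using ha)

theorem greedyProd_sum_le_prod {ι : Type*} (hl : 0 < l) (ha : 0 ≤ a) (hla : l * a ≤ 1)
    (s : Finset ι) (x : ι → ℕ) (hx : ∀ v ∈ s, x v ≤ l) :
    greedyProd l a (∑ v ∈ s, x v) ≤ ∏ v ∈ s, (1 - x v * a) := by
  classical
  induction s using Finset.induction_on with
  | empty => simp [greedyProd]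
  | insert v s hv ih =>
    rw [Finset.sum_insert hv, Finset.prod_insert hv, add_comm]
    have hxv := hx v (Finset.mem_insert_self _ _)
    have : (x v : ℝ) * a ≤ l * a := mul_le_mul_of_nonneg_right (by exact_mod_cast hxv) ha
    exact (greedyProd_add_le hl hla _ hxv).trans (mul_le_mul_of_nonneg_left
      (ih fun v hv => hx v (Finset.mem_insert_of_mem hv)) (by linarith))

end Majorization

/-! ### Exchanging members of an independent family -/

section Exchange

variable {F J O K M : Type*} [Field F] [AddCommGroup K] [Module F K] [AddCommGroup M] [Module F M]

theorem linearIndependent_mkQ_comap_iff (L : K →ₗ[F] M) (B : Submodule F M) {ι : Type*}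
    (v : ι → K) : LinearIndependent F ((B.comap L).mkQ ∘ v) ↔
      LinearIndependent F (B.mkQ ∘ L ∘ v) := by
  have hker : LinearMap.ker ((B.comap L).mapQ B L le_rfl) = ⊥ := by
    rw [Submodule.ker_mapQ]
    exact Submodule.mkQ_map_self _
  rw [← LinearMap.linearIndependent_iff _ hker]
  rfl

/-- If some members of an independent family lie in the range of `L`, then modulo the others this
range is at least as large as their number. -/
theorem card_le_finrank_quotient_comap [FiniteDimensional F K] (L : K →ₗ[F] M) {g : J → M}
    (hg : LinearIndependent F g) (C : Finset J) (hC : ∀ j ∈ C, g j ∈ LinearMap.range L) :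
    C.card ≤
      Module.finrank F (K ⧸ (Submodule.span F (g '' (C : Set J)ᶜ)).comap L) := by
  choose z hz using fun j : C => hC j j.2
  have h := (linearIndepOn_union_iff_quotient (R := F) (f := g) (s := (C : Set J)ᶜ)
    (t := (C : Set J)) disjoint_compl_left).1 (hg.linearIndepOn _)
  have h2 : LinearIndependent F ((Submodule.span F (g '' (C : Set J)ᶜ)).mkQ ∘ L ∘ z) := by
    have : L ∘ z = fun j : C => g j := funext hz
    rw [this]
    exact h.2
  simpa using ((linearIndependent_mkQ_comap_iff L _ z).2 h2).fintype_card_le_finrank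

/-- Replacing some members of an independent family by vectors that are independent modulo the
others yields an independent family. -/
theorem linearIndependent_of_exchange (L : K →ₗ[F] M) {g g' : J → M}
    (hg : LinearIndependent F g) (C : Finset J) (hg' : ∀ j ∉ C, g' j = g j)
    (y : O → K) (f : C → O) (hf : Function.Injective f) (hy : ∀ j : C, g' j = L (y (f j)))
    (hind : LinearIndepOn F
      (((Submodule.span F (g '' (C : Set J)ᶜ)).comap L).mkQ ∘ y) (Set.range f)) :
    LinearIndependent F g' := by
  rw [← linearIndepOn_univ_iff, ← Set.compl_union_self (C : Set J),
    linearIndepOn_union_iff_quotient disjoint_compl_left]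
  have heq : Set.EqOn g g' (C : Set J)ᶜ := fun j hj => (hg' j (by simpa using hj)).symm
  refine ⟨(hg.linearIndepOn _).congr heq, ?_⟩
  rw [← heq.image_eq]
  rw [linearIndepOn_range_iff hf, Function.comp_assoc, linearIndependent_mkQ_comap_iff] at hind
  have : (fun j : C => g' j) = L ∘ y ∘ f := funext hy
  rw [← this] at hind
  exact hind

end Exchange

/-! ### Frontiers of paths, and kernels under resampling at a node -/

namespace Network

variable {V E F : Type*} [DecidableEq V]

/-- The first channel of the path `d :: p` whose head is not in `Z`, or its last channel. -/
def frontier (N : Network V E) (w : ℕ) (Z : Finset V) : Fin w ⊕ E → List E → Fin w ⊕ E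
  | d, [] => d
  | d, e :: p => if N.extHead w d ∈ Z then frontier N w Z (Sum.inr e) p else d

section Frontier

variable {N : Network V E} {w : ℕ} {Z : Finset V}

theorem frontier_of_notMem {d : Fin w ⊕ E} (h : N.extHead w d ∉ Z) (p : List E) :
    N.frontier w Z d p = d := by
  cases p <;> simp [frontier, h]

theorem head_ne_tail {V E : Type*} (N : Network V E) (e : E) : N.head e ≠ N.tail e := fun h =>
  N.acyclic (N.tail e) (Relation.TransGen.single ⟨e, rfl, h⟩)

theorem frontier_eq_or (d : Fin w ⊕ E) (p : List E) (hd : ∀ e ∈ p.head?, N.extHead w d = N.tail e)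
    (hp : p.IsChain N.Follows) :
    N.frontier w Z d p = d ∨ ∃ e ∈ p, N.tail e ∈ Z ∧ N.frontier w Z d p = Sum.inr e := by
  induction p generalizing d with
  | nil => exact Or.inl rfl
  | cons e p ih =>
    by_cases h : N.extHead w d ∈ Z
    · rw [frontier, if_pos h]
      right
      have he : N.tail e ∈ Z := hd e (by simp) ▸ h
      obtain h' | ⟨e', he', ht, hf⟩ := ih (Sum.inr e)
        (fun e' he' => (List.isChain_cons.1 hp).1 e' he') (List.isChain_cons.1 hp).2
      · exact ⟨e, by simp, he, h'⟩
      · exact ⟨e', by simp [he'], ht, hf⟩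
    · exact Or.inl (frontier_of_notMem h _)

/-- A frontier moves by at most one channel: the next channel leaves `v`, and its head is neither
`v`, by acyclicity, nor in `Z`, since `Z` is closed under predecessors and `v ∉ Z`. -/
theorem frontier_insert_eq_or {v : V} (hZ : ∀ e, N.head e ∈ Z → N.tail e ∈ Z) (hv : v ∉ Z)
    (d : Fin w ⊕ E) (p : List E) (hd : ∀ e ∈ p.head?, N.extHead w d = N.tail e)
    (hp : p.IsChain N.Follows) :
    N.frontier w (insert v Z) d p = N.frontier w Z d p ∨
      N.extHead w (N.frontier w Z d p) = v ∧
        ∃ e ∈ p, N.tail e = v ∧ N.frontier w (insert v Z) d p = Sum.inr e := by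
  induction p generalizing d with
  | nil => exact Or.inl rfl
  | cons e p ih =>
    by_cases h : N.extHead w d ∈ Z
    · rw [frontier, frontier, if_pos h, if_pos (Finset.mem_insert_of_mem h)]
      obtain h' | ⟨h', e', he', hf⟩ := ih (Sum.inr e)
        (fun e' he' => (List.isChain_cons.1 hp).1 e' he') (List.isChain_cons.1 hp).2
      · exact Or.inl h'
      · exact Or.inr ⟨h', e', by simp [he'], hf⟩
    · rw [frontier_of_notMem h]
      by_cases h' : N.extHead w d = v
      · right
        have het : N.tail e = v := (hd e (by simp)).symm.trans h'
        refine ⟨h', e, by simp, het, ?_⟩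
        rw [frontier, if_pos (by simp [h']), frontier_of_notMem]
        rw [Finset.mem_insert, not_or]
        exact ⟨fun h => N.head_ne_tail e (h.trans het.symm), fun h => hv (het ▸ hZ e h)⟩
      · left
        rw [frontier_of_notMem]
        simp [h, h']

theorem frontier_univ [Fintype V] (d : Fin w ⊕ E) {p : List E} (hp : p ≠ []) :
    N.frontier w Finset.univ d p = Sum.inr (p.getLast hp) := by
  induction p generalizing d with
  | nil => exact absurd rfl hp
  | cons e p ih =>
    rw [frontier, if_pos (Finset.mem_univ _)]
    cases p with
    | nil => rfl
    | cons e' p => rw [ih _ (by simp), List.getLast_cons_cons]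

end Frontier

section Kernels

variable [Fintype E] [Field F] {N : Network V E} {w : ℕ}

/-- The kernels of all channels, including the imaginary ones. -/
noncomputable def extKernel (N : Network V E) (w : ℕ) (k : N.AdjPair w → F) :
    Fin w ⊕ E → Fin w → F :=
  Sum.elim (fun i => Pi.single i 1) (N.globalKernel w k)

/-- The kernel of a channel leaving `v` as a function of its local coefficients. -/
noncomputable def nodeMap (N : Network V E) (w : ℕ) (k : N.AdjPair w → F) (v : V) :
    ({d : Fin w ⊕ E // N.extHead w d = v} → F) →ₗ[F] (Fin w → F) :=
  Fintype.linearCombination F fun d => N.extKernel w k d.1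

/-- Replace the local coefficients of the channels leaving `v`. -/
def resample (N : Network V E) (w : ℕ) (v : V) (k : N.AdjPair w → F)
    (y : {e : E // N.tail e = v} → {d : Fin w ⊕ E // N.extHead w d = v} → F) :
    N.AdjPair w → F := fun p =>
  if h : N.tail p.1.2 = v then y ⟨p.1.2, h⟩ ⟨p.1.1, p.2.trans h⟩ else k p

/-- A kernel depends only on upstream coefficients; hence redrawing those at an unprocessed node
leaves the current frontier kernels fixed. -/
theorem globalKernel_congr {Z : Finset V} (hZ : ∀ e, N.head e ∈ Z → N.tail e ∈ Z)
    {k k' : N.AdjPair w → F} (hk : ∀ p : N.AdjPair w, N.tail p.1.2 ∈ Z → k p = k' p) (e : E)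
    (he : N.tail e ∈ Z) : N.globalKernel w k e = N.globalKernel w k' e := by
  induction e using N.wellFounded_follows.induction with
  | _ e ih =>
    rw [globalKernel_eq, globalKernel_eq]
    refine Finset.sum_congr rfl ?_
    rintro ⟨i | d, hd⟩ _
    · rw [hk _ he]
      rfl
    · rw [hk _ he]
      have hd' : N.head d = N.tail e := hd
      simp only [Sum.elim_inr]
      rw [ih d hd' (hZ d (hd'.symm ▸ he))]

theorem extKernel_resample {Z : Finset V} {v : V} (hZ : ∀ e, N.head e ∈ Z → N.tail e ∈ Z)
    (hv : v ∉ Z) (k : N.AdjPair w → F)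
    (y : {e : E // N.tail e = v} → {d : Fin w ⊕ E // N.extHead w d = v} → F)
    (d : Fin w ⊕ E) (hd : ∀ e, d = Sum.inr e → N.tail e ∈ Z) :
    N.extKernel w (N.resample w v k y) d = N.extKernel w k d := by
  obtain i | e := d
  · rfl
  · refine globalKernel_congr hZ (fun p hp => ?_) e (hd e rfl)
    rw [resample, dif_neg]
    exact fun h => hv (h ▸ hp)

theorem globalKernel_resample {Z : Finset V} {v : V} (hZ : ∀ e, N.head e ∈ Z → N.tail e ∈ Z)
    (hv : v ∉ Z) (hpre : ∀ e, N.head e = v → N.tail e ∈ Z) (k : N.AdjPair w → F)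
    (y : {e : E // N.tail e = v} → {d : Fin w ⊕ E // N.extHead w d = v} → F)
    (e : {e : E // N.tail e = v}) :
    N.globalKernel w (N.resample w v k y) e.1 = N.nodeMap w k v (y e) := by
  obtain ⟨e, rfl⟩ := e
  rw [globalKernel_eq, nodeMap, Fintype.linearCombination_apply]
  refine Finset.sum_congr rfl fun d _ => ?_
  congr 1
  · simp [resample]
  · refine extKernel_resample hZ hv k y d.1 fun e' he' => hpre e' ?_
    have := d.2
    rw [he'] at this
    exact this

theorem extKernel_mem_range_nodeMap (k : N.AdjPair w → F) {v : V} {d : Fin w ⊕ E}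
    (hd : N.extHead w d = v) : N.extKernel w k d ∈ LinearMap.range (N.nodeMap w k v) := by
  classical
  exact ⟨Pi.single ⟨d, hd⟩ 1, by simp [nodeMap, Fintype.linearCombination_apply_single]⟩

end Kernels

end Network

/-! ### Adding one node to the processed set -/

namespace Network

variable {V E F : Type*} [DecidableEq V]

section Step

variable {N : Network V E} {w : ℕ} {Z : Finset V} {v t : V} {Q : Fin w → List E}

theorem IsSourcePath.ne_nil {V E : Type*} {N : Network V E} {t : V} {p : List E}
    (h : N.IsSourcePath t p) : p ≠ [] := by
  rintro rfl
  simpa using h.first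

theorem IsSourcePath.source_eq {V E : Type*} {N : Network V E} {t : V} {p : List E}
    (h : N.IsSourcePath t p) : ∀ e ∈ p.head?, N.source = N.tail e := by
  intro e he
  have := h.first
  rw [Option.mem_def.1 he] at this
  simpa using this.symm

open Classical in
/-- The paths whose frontier channel changes when `v` is added to `Z`. -/
noncomputable def movers (N : Network V E) {w : ℕ} (Z : Finset V) (v : V) (Q : Fin w → List E) :
    Finset (Fin w) :=
  {j | N.frontier w (insert v Z) (Sum.inl j) (Q j) ≠ N.frontier w Z (Sum.inl j) (Q j)}

open Classical in
/-- The channels that enter the frontier when `v` is added to `Z`. -/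
noncomputable def newChannels [Fintype E] (N : Network V E) {w : ℕ} (Z : Finset V) (v : V)
    (Q : Fin w → List E) : Finset {e : E // N.tail e = v} :=
  {e | ∃ j ∈ N.movers Z v Q, N.frontier w (insert v Z) (Sum.inl j) (Q j) = Sum.inr e.1}

theorem mover_spec (hQ : N.IsDisjointPaths t Q) (hZ : ∀ e, N.head e ∈ Z → N.tail e ∈ Z)
    (hv : v ∉ Z) {j : Fin w} (hj : j ∈ N.movers Z v Q) :
    N.extHead w (N.frontier w Z (Sum.inl j) (Q j)) = v ∧ ∃ e : {e : E // N.tail e = v}, e.1 ∈ Q j ∧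
      N.frontier w (insert v Z) (Sum.inl j) (Q j) = Sum.inr e.1 := by
  have hj' : N.frontier w (insert v Z) (Sum.inl j) (Q j) ≠ N.frontier w Z (Sum.inl j) (Q j) := by
    simpa [movers] using hj
  obtain h | ⟨h, e, he, het, hf⟩ := frontier_insert_eq_or hZ hv (Sum.inl j) (Q j)
    (hQ.path j).source_eq (hQ.path j).chain
  · exact absurd h hj'
  · exact ⟨h, ⟨e, het⟩, he, hf⟩

theorem exists_mem_of_mem_newChannels [Fintype E] (hQ : N.IsDisjointPaths t Q)
    (hZ : ∀ e, N.head e ∈ Z → N.tail e ∈ Z) (hv : v ∉ Z) {e : {e : E // N.tail e = v}}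
    (he : e ∈ N.newChannels Z v Q) : ∃ j, e.1 ∈ Q j := by
  obtain ⟨j, hj, hje⟩ : ∃ j ∈ N.movers Z v Q,
    N.frontier w (insert v Z) (Sum.inl j) (Q j) = Sum.inr e.1 := by simpa [newChannels] using he
  obtain ⟨-, e', he', hf⟩ := mover_spec hQ hZ hv hj
  rw [hje] at hf
  exact ⟨j, Sum.inr_injective hf ▸ he'⟩

theorem exists_newChannels_parametrization [Fintype E] (hQ : N.IsDisjointPaths t Q)
    (hZ : ∀ e, N.head e ∈ Z → N.tail e ∈ Z) (hv : v ∉ Z) :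
    ∃ f : N.movers Z v Q → {e : E // N.tail e = v}, Function.Injective f ∧
      Set.range f = (N.newChannels Z v Q : Set {e : E // N.tail e = v}) ∧
      ∀ j : N.movers Z v Q,
        N.frontier w (insert v Z) (Sum.inl j.1) (Q j.1) = Sum.inr (f j).1 := by
  choose f hfm hf using fun j : N.movers Z v Q => (mover_spec hQ hZ hv j.2).2
  refine ⟨f, fun i j hij => ?_, ?_, hf⟩
  · by_contra hne
    have := hQ.disjoint i j (fun h => hne (Subtype.ext h))
    exact this (hfm i) (hij ▸ hfm j)
  · ext e
    simp only [newChannels, Finset.coe_filter, Finset.mem_univ, true_and, Set.mem_range,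
      Set.mem_ofPred_eq]
    constructor
    · rintro ⟨j, rfl⟩
      exact ⟨j, j.2, hf j⟩
    · rintro ⟨j, hj, hje⟩
      refine ⟨⟨j, hj⟩, Subtype.ext (Sum.inr_injective (β := E) (α := Fin w) ?_)⟩
      rw [← hf ⟨j, hj⟩, hje]

theorem card_newChannels [Fintype E] (hQ : N.IsDisjointPaths t Q)
    (hZ : ∀ e, N.head e ∈ Z → N.tail e ∈ Z) (hv : v ∉ Z) :
    (N.newChannels Z v Q).card = (N.movers Z v Q).card := by
  obtain ⟨f, hf, hr, -⟩ := exists_newChannels_parametrization hQ hZ hv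
  have h := Set.ncard_coe_finset (N.newChannels Z v Q)
  rw [← h, ← hr, ← Set.image_univ, Set.ncard_image_of_injective _ hf, Set.ncard_univ]
  simp

variable [Fintype E] [Field F]

/-- The kernels of the frontier channels of the paths `Q` are linearly independent. -/
def FrontierIndep (N : Network V E) (w : ℕ) (Z : Finset V) (Q : Fin w → List E)
    (k : N.AdjPair w → F) : Prop :=
  LinearIndependent F fun j => N.extKernel w k (N.frontier w Z (Sum.inl j) (Q j))

/-- The local coefficient vectors at `v` for which the channel kernel is in the span of the
frontier kernels that do not change at `v`. -/
noncomputable def stayingSubspace (N : Network V E) (w : ℕ) (Z : Finset V) (v : V)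
    (Q : Fin w → List E) (k : N.AdjPair w → F) :
    Submodule F ({d : Fin w ⊕ E // N.extHead w d = v} → F) :=
  (Submodule.span F ((fun j => N.extKernel w k (N.frontier w Z (Sum.inl j) (Q j))) ''
    (N.movers Z v Q : Set (Fin w))ᶜ)).comap (N.nodeMap w k v)

/-- There are as many new channels as moving paths. The old frontier channels of the latter enter
`v`, so their kernels lie in the range of `nodeMap` and are independent modulo the staying ones. -/
theorem FrontierIndep.card_newChannels_le {k : N.AdjPair w → F} (h : N.FrontierIndep w Z Q k)
    (hQ : N.IsDisjointPaths t Q) (hZ : ∀ e, N.head e ∈ Z → N.tail e ∈ Z) (hv : v ∉ Z) :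
    (N.newChannels Z v Q).card ≤ Module.finrank F
      (({d : Fin w ⊕ E // N.extHead w d = v} → F) ⧸ N.stayingSubspace w Z v Q k) := by
  rw [card_newChannels hQ hZ hv]
  exact card_le_finrank_quotient_comap (N.nodeMap w k v) h _ fun j hj =>
    extKernel_mem_range_nodeMap k (mover_spec hQ hZ hv hj).1

theorem frontier_resample (hQ : N.IsDisjointPaths t Q)
    (hZ : ∀ e, N.head e ∈ Z → N.tail e ∈ Z) (hv : v ∉ Z) (k : N.AdjPair w → F)
    (y : {e : E // N.tail e = v} → {d : Fin w ⊕ E // N.extHead w d = v} → F) (j : Fin w) :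
    N.extKernel w (N.resample w v k y) (N.frontier w Z (Sum.inl j) (Q j)) =
      N.extKernel w k (N.frontier w Z (Sum.inl j) (Q j)) := by
  refine extKernel_resample hZ hv k y _ fun e he => ?_
  obtain h | ⟨e', -, ht, hf⟩ := frontier_eq_or (Z := Z) (Sum.inl j) (Q j)
    (hQ.path j).source_eq (hQ.path j).chain
  · rw [h] at he
    cases he
  · rw [hf] at he
    exact Sum.inr_injective he ▸ ht

theorem FrontierIndep.insert_resample {k : N.AdjPair w → F} (h : N.FrontierIndep w Z Q k)
    (hQ : N.IsDisjointPaths t Q) (hZ : ∀ e, N.head e ∈ Z → N.tail e ∈ Z) (hv : v ∉ Z)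
    (hpre : ∀ e, N.head e = v → N.tail e ∈ Z)
    (y : {e : E // N.tail e = v} → {d : Fin w ⊕ E // N.extHead w d = v} → F)
    (hy : IndepMod (N.stayingSubspace w Z v Q k) y (N.newChannels Z v Q)) :
    N.FrontierIndep w (insert v Z) Q (N.resample w v k y) := by
  obtain ⟨f, hf, hr, hfr⟩ := exists_newChannels_parametrization hQ hZ hv
  refine linearIndependent_of_exchange (N.nodeMap w k v) h (N.movers Z v Q) (fun j hj => ?_) y f hf
    (fun j => ?_) (hr ▸ hy)
  · have : N.frontier w (insert v Z) (Sum.inl j) (Q j) = N.frontier w Z (Sum.inl j) (Q j) := by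
      simpa [movers] using hj
    rw [this, frontier_resample hQ hZ hv]
  · rw [hfr j]
    exact globalKernel_resample hZ hv hpre k y (f j)

theorem FrontierIndep.insert_resample_of_forall_tail_ne {k : N.AdjPair w → F}
    (h : N.FrontierIndep w Z Q k)
    (hQ : N.IsDisjointPaths t Q) (hZ : ∀ e, N.head e ∈ Z → N.tail e ∈ Z) (hv : v ∉ Z)
    (hpre : ∀ e, N.head e = v → N.tail e ∈ Z)
    (y : {e : E // N.tail e = v} → {d : Fin w ⊕ E // N.extHead w d = v} → F)
    (hne : ∀ j, ∀ e ∈ Q j, N.tail e ≠ v) :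
    N.FrontierIndep w (insert v Z) Q (N.resample w v k y) := by
  refine h.insert_resample hQ hZ hv hpre y ?_
  have : N.newChannels Z v Q = ∅ := Finset.eq_empty_of_forall_notMem fun e he => by
    obtain ⟨j, hj⟩ := exists_mem_of_mem_newChannels hQ hZ hv he
    exact hne j e hj e.2
  rw [this]
  simp [IndepMod]

variable [Fintype F]

open Classical in
theorem mul_countReal_frontierIndep_le (T S R : Finset V) (P : V → Fin w → List E)
    (hP : ∀ t ∈ T, N.IsDisjointPaths t (P t)) (hZ : ∀ e, N.head e ∈ Z → N.tail e ∈ Z) (hv : v ∉ Z)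
    (hpre : ∀ e, N.head e = v → N.tail e ∈ Z) (hST : S ⊆ T) (hRT : R ⊆ T)
    (hcover : ∀ t ∈ T, t ∉ S → t ∉ R → ∀ j, ∀ e ∈ P t j, N.tail e ≠ v)
    (hS : ∀ t ∈ S, ∀ j, ∀ e ∈ P t j, N.tail e = v → N.head e = t)
    (hR : (R.card : ℝ) * singularProb (Fintype.card F) w ≤ 1) :
    (1 - singularProb (Fintype.card F) w) ^ S.card *
        (1 - R.card * singularProb (Fintype.card F) w) *
        countReal (fun k : N.AdjPair w → F => ∀ t ∈ T, N.FrontierIndep w Z (P t) k) ≤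
      countReal (fun k : N.AdjPair w → F => ∀ t ∈ T, N.FrontierIndep w (insert v Z) (P t) k) := by
  set Y := {e : E // N.tail e = v} → {d : Fin w ⊕ E // N.extHead w d = v} → F with hY
  have hYpos : (0 : ℝ) < Fintype.card Y := by exact_mod_cast Fintype.card_pos
  refine le_of_mul_le_mul_left ?_ hYpos
  rw [card_mul_countReal_eq_sum_resample (Y := Y) (N.resample w v)
    (fun k e d => k ⟨(d.1, e.1), d.2.trans e.2.symm⟩)]
  -- A channel that is new for two sinks of `S` would have both as its head.
  · have hdisj : (S : Set V).PairwiseDisjoint fun t => N.newChannels Z v (P t) := by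
      intro t ht t' ht' hne
      refine Finset.disjoint_left.2 fun e he he' => hne ?_
      obtain ⟨j, hj⟩ := exists_mem_of_mem_newChannels (hP t (hST ht)) hZ hv he
      obtain ⟨j', hj'⟩ := exists_mem_of_mem_newChannels (hP t' (hST ht')) hZ hv he'
      rw [← hS t ht j e hj e.2, ← hS t' ht' j' e hj' e.2]
    have key : ∀ k : N.AdjPair w → F, (∀ t ∈ T, N.FrontierIndep w Z (P t) k) →
        (1 - singularProb (Fintype.card F) w) ^ S.card *
          (1 - R.card * singularProb (Fintype.card F) w) * Fintype.card Y ≤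
        countReal (fun y : Y =>
          (∀ t ∈ S, IndepMod (N.stayingSubspace w Z v (P t) k) y (N.newChannels Z v (P t))) ∧
          ∀ t ∈ R, IndepMod (N.stayingSubspace w Z v (P t) k) y (N.newChannels Z v (P t))) := by
      intro k hk
      have hle : ∀ t ∈ S ∪ R, t ∈ T := fun t ht => by
        rcases Finset.mem_union.1 ht with h | h
        exacts [hST h, hRT h]
      refine card_mul_le_countReal_indepMod (w := w) S R
        (fun t => N.stayingSubspace w Z v (P t) k) (fun t => N.newChannels Z v (P t)) hdisj
        (fun t ht => ?_) (fun t ht => ?_) hR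
      · exact (hk t (hle t ht)).card_newChannels_le (hP t (hle t ht)) hZ hv
      · rw [card_newChannels (hP t (hle t ht)) hZ hv]
        exact (Finset.card_le_univ _).trans (by simp)
    calc _ = (1 - singularProb (Fintype.card F) w) ^ S.card *
          (1 - R.card * singularProb (Fintype.card F) w) * Fintype.card Y *
          countReal (fun k : N.AdjPair w → F => ∀ t ∈ T, N.FrontierIndep w Z (P t) k) := by ring
      _ ≤ _ := le_sum_countReal_and _ _ _ key
      _ ≤ _ := Finset.sum_le_sum fun k _ => countReal_mono fun y hy t ht => by
        by_cases htS : t ∈ S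
        · exact (hy.1 t ht).insert_resample (hP t ht) hZ hv hpre y (hy.2.1 t htS)
        · by_cases htR : t ∈ R
          · exact (hy.1 t ht).insert_resample (hP t ht) hZ hv hpre y (hy.2.2 t htR)
          · exact (hy.1 t ht).insert_resample_of_forall_tail_ne (hP t ht) hZ hv hpre y
              (hcover t ht htS htR)
  · intro k y
    ext ⟨e, he⟩ d
    simp [resample, he]
  · intro k y
    ext ⟨⟨d, e⟩, hd⟩
    by_cases he : N.tail e = v <;> simp [resample, he]

end Step

end Network

/-! ### From probability to counting -/

/-- Independence and uniformity make all coefficient assignments equally likely; measure theory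
enters the estimate only through this fact. -/
theorem measureReal_eq_countReal_div {Ω ι F : Type*} [Fintype ι] [DecidableEq ι] [Fintype F]
    [MeasurableSpace F]
    [MeasurableSingletonClass F] [MeasurableSpace Ω] (μ : Measure Ω) [IsProbabilityMeasure μ]
    (k : ι → Ω → F) (hk_meas : ∀ p, Measurable (k p)) (hk_indep : iIndepFun k μ)
    (hk_unif : ∀ p c, μ.real (k p ⁻¹' {c}) = 1 / (Fintype.card F : ℝ)) (Q : (ι → F) → Prop) :
    μ.real {ω | Q fun p => k p ω} = countReal Q / Fintype.card (ι → F) := by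
  classical
  have hset : ∀ x : ι → F, {ω | (fun p => k p ω) = x} = ⋂ p ∈ Finset.univ, k p ⁻¹' {x p} := by
    intro x
    ext ω
    simp [funext_iff]
  have hmeas : ∀ x : ι → F, MeasurableSet {ω | (fun p => k p ω) = x} := fun x => by
    rw [hset]
    exact Finset.measurableSet_biInter _ fun p _ => hk_meas p (measurableSet_singleton _)
  have hpt : ∀ x : ι → F,
      μ.real {ω | (fun p => k p ω) = x} = 1 / (Fintype.card (ι → F) : ℝ) := by
    intro x
    rw [hset, Measure.real, hk_indep.measure_inter_preimage_eq_mul Finset.univ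
      (sets := fun p => {x p}) (fun p _ => measurableSet_singleton _), ENNReal.toReal_prod]
    have : ∀ p, (μ (k p ⁻¹' {x p})).toReal = 1 / (Fintype.card F : ℝ) := fun p => hk_unif p _
    simp [this]
  have hU : {ω | Q fun p => k p ω} =
      ⋃ x ∈ (Finset.univ.filter Q : Finset (ι → F)), {ω | (fun p => k p ω) = x} := by
    ext ω
    simp
  rw [hU, measureReal_biUnion_finset]
  · simp only [hpt, Finset.sum_const, nsmul_eq_mul, countReal]
    rw [mul_one_div]
  · intro x _ x' _ hne
    exact Set.disjoint_left.2 fun ω h h' => hne (h.symm.trans h')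
  · exact fun x _ => hmeas x

/-! ### Tails of path channels and the last tail -/

namespace Network

section Paths

variable {V E : Type*} {N : Network V E}

theorem head_eq_or_exists_tail_eq {t : V} {p : List E} (hl : p.getLast?.map N.head = some t)
    (hp : p.IsChain N.Follows) {e : E} (he : e ∈ p) :
    N.head e = t ∨ ∃ e' ∈ p, N.tail e' = N.head e := by
  induction p with
  | nil => simp at he
  | cons d p ih =>
    cases p with
    | nil =>
      obtain rfl : e = d := by simpa using he
      exact Or.inl (by simpa using hl)
    | cons d' p =>
      rw [List.isChain_cons_cons] at hp
      rcases List.mem_cons.1 he with rfl | he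
      · exact Or.inr ⟨d', by simp, hp.1.symm⟩
      · rw [List.getLast?_cons_cons] at hl
        obtain h | ⟨e', he', h⟩ := ih hl hp.2 he
        exacts [Or.inl h, Or.inr ⟨e', List.mem_cons_of_mem _ he', h⟩]

theorem transGen_tail_of_mem {t : V} {p : List E} (hl : p.getLast?.map N.head = some t)
    (hp : p.IsChain N.Follows) {e : E} (he : e ∈ p) :
    Relation.TransGen (fun i j => ∃ e, N.tail e = i ∧ N.head e = j) (N.tail e) t := by
  induction p generalizing e with
  | nil => simp at he
  | cons d p ih =>
    cases p with
    | nil =>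
      obtain rfl : e = d := by simpa using he
      exact Relation.TransGen.single ⟨e, rfl, by simpa using hl⟩
    | cons d' p =>
      rw [List.isChain_cons_cons] at hp
      rw [List.getLast?_cons_cons] at hl
      rcases List.mem_cons.1 he with rfl | he
      · exact Relation.TransGen.head ⟨e, rfl, hp.1⟩ (ih hl hp.2 (by simp))
      · exact ih hl hp.2 he

theorem IsSourcePath.tail_ne {t : V} {p : List E} (h : N.IsSourcePath t p) {e : E} (he : e ∈ p) :
    N.tail e ≠ t := fun het => by
  have := transGen_tail_of_mem h.last h.chain he
  rw [het] at this
  exact N.acyclic t this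

/-- Every nonempty set of nodes of a finite network has a node with no channel into the set. -/
theorem exists_mem_forall_head_notMem [Finite V] (N : Network V E) {Z : Set V} (hZ : Z.Nonempty) :
    ∃ v ∈ Z, ∀ e, N.tail e = v → N.head e ∉ Z := by
  let r : V → V → Prop := fun i j =>
    Relation.TransGen (fun i j => ∃ e, N.tail e = i ∧ N.head e = j) j i
  have : Std.Irrefl r := ⟨N.acyclic⟩
  have : IsTrans V r := ⟨fun _ _ _ h h' => h'.trans h⟩
  obtain ⟨v, hv, h⟩ := (Finite.wellFounded_of_trans_of_irrefl r).has_min Z hZ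
  exact ⟨v, hv, fun e he hm => h _ hm (Relation.TransGen.single ⟨e, he, rfl⟩)⟩

variable [Fintype V] {w : ℕ} {Q : Fin w → List E} {t : V}

open Classical in
/-- The tails of the channels on the paths `Q`. -/
noncomputable def pathTails (N : Network V E) (Q : Fin w → List E) : Finset V :=
  {v | ∃ j, ∃ e ∈ Q j, N.tail e = v}

theorem mem_pathTails {v : V} : v ∈ N.pathTails Q ↔ ∃ j, ∃ e ∈ Q j, N.tail e = v := by
  simp [pathTails]

/-- Acyclicity keeps `t` from being a tail, so every tail is internal or the source; the source
accounts for the `+ 1`. -/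
theorem IsDisjointPaths.card_pathTails_le (hQ : N.IsDisjointPaths t Q) :
    (N.pathTails Q).card ≤ N.numInternal t Q + 1 := by
  classical
  have hsub : ((N.pathTails Q).erase N.source : Set V) ⊆
      {v : V | v ≠ N.source ∧ v ≠ t ∧ ∃ j, ∃ e ∈ Q j, N.tail e = v ∨ N.head e = v} := by
    intro v hv
    obtain ⟨hne, hv⟩ := Finset.mem_erase.1 (Finset.mem_coe.1 hv)
    obtain ⟨j, e, he, rfl⟩ := mem_pathTails.1 hv
    exact ⟨hne, (hQ.path j).tail_ne he, j, e, he, Or.inl rfl⟩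
  have h := Set.ncard_le_ncard hsub (Set.toFinite _)
  rw [Set.ncard_coe_finset] at h
  have h2 := Finset.pred_card_le_card_erase (s := N.pathTails Q) (a := N.source)
  unfold numInternal
  omega

/-- Take a topologically last tail: a path channel leaving it that missed `t` would be followed by a
channel whose tail comes later. -/
theorem IsDisjointPaths.exists_last_tail (hQ : N.IsDisjointPaths t Q) (hw : 0 < w) :
    ∃ z ∈ N.pathTails Q, ∀ j, ∀ e ∈ Q j, N.tail e = z → N.head e = t := by
  have hne : (N.pathTails Q : Set V).Nonempty := by
    obtain ⟨e, p, he⟩ := List.exists_cons_of_ne_nil (hQ.path ⟨0, hw⟩).ne_nil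
    exact ⟨N.tail e, mem_pathTails.2 ⟨⟨0, hw⟩, e, by simp [he], rfl⟩⟩
  obtain ⟨z, hz, h⟩ := N.exists_mem_forall_head_notMem hne
  refine ⟨z, hz, fun j e he hez => ?_⟩
  obtain h' | ⟨e', he', ht⟩ := head_eq_or_exists_tail_eq (hQ.path j).last (hQ.path j).chain he
  · exact h'
  · exact absurd (mem_pathTails.2 ⟨j, e', he', ht⟩) (h e hez)

end Paths

/-! ### Accumulating the factors over all nodes -/

variable {V E F Ω : Type*} [DecidableEq V] [Fintype E] [Field F]
  {N : Network V E} {w : ℕ}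

theorem frontierIndep_empty (Q : Fin w → List E) (k : N.AdjPair w → F) :
    N.FrontierIndep w ∅ Q k := by
  have : (fun j => N.extKernel w k (N.frontier w ∅ (Sum.inl j) (Q j))) =
      fun j => Pi.single j (1 : F) := by
    funext j
    rw [frontier_of_notMem (by simp)]
    rfl
  unfold FrontierIndep
  rw [this]
  exact Pi.linearIndependent_single_one _ _

variable [Fintype V]

theorem FrontierIndep.le_rank {t : V} {Q : Fin w → List E} {k : N.AdjPair w → F}
    (h : N.FrontierIndep w Finset.univ Q k) (hQ : N.IsDisjointPaths t Q) :
    w ≤ (N.decodingMatrix w k t).rank := by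
  have h1 := finrank_span_eq_card h
  rw [Fintype.card_fin] at h1
  rw [Matrix.rank_eq_finrank_span_cols]
  refine h1.symm.le.trans (Submodule.finrank_mono (Submodule.span_mono ?_))
  rintro _ ⟨j, rfl⟩
  have hne := (hQ.path j).ne_nil
  have hl := (hQ.path j).last
  rw [List.getLast?_eq_getLast_of_ne_nil hne] at hl
  refine ⟨⟨(Q j).getLast hne, by simpa using hl⟩, ?_⟩
  beta_reduce
  rw [frontier_univ _ hne]
  rfl

variable [Fintype F]

open Classical in
theorem prod_mul_card_le_countReal_frontierIndep (T : Finset V) (P : V → Fin w → List E)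
    (hP : ∀ t ∈ T, N.IsDisjointPaths t (P t)) (S R : V → Finset V) (hST : ∀ v, S v ⊆ T)
    (hRT : ∀ v, R v ⊆ T)
    (hcover : ∀ v, ∀ t ∈ T, t ∉ S v → t ∉ R v → ∀ j, ∀ e ∈ P t j, N.tail e ≠ v)
    (hS : ∀ v, ∀ t ∈ S v, ∀ j, ∀ e ∈ P t j, N.tail e = v → N.head e = t)
    (hR : ∀ v, ((R v).card : ℝ) * singularProb (Fintype.card F) w ≤ 1)
    (Z : Finset V) (hZ : ∀ e, N.head e ∈ Z → N.tail e ∈ Z) :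
    (∏ v ∈ Z, ((1 - singularProb (Fintype.card F) w) ^ (S v).card *
        (1 - (R v).card * singularProb (Fintype.card F) w))) *
        Fintype.card (N.AdjPair w → F) ≤
      countReal (fun k : N.AdjPair w → F => ∀ t ∈ T, N.FrontierIndep w Z (P t) k) := by
  induction hn : Z.card generalizing Z with
  | zero =>
    obtain rfl := Finset.card_eq_zero.1 hn
    rw [Finset.prod_empty, one_mul, ← countReal_true]
    exact countReal_mono fun k _ t _ => frontierIndep_empty _ k
  | succ m ih =>
    -- A topologically last node of `Z`: erasing it keeps the set closed under predecessors, and all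
    -- predecessors of `v` remain.
    obtain ⟨v, hv, hmax⟩ := N.exists_mem_forall_head_notMem (Z := (Z : Set V))
      (Finset.coe_nonempty.2 (Finset.card_pos.1 (by omega)))
    have hv : v ∈ Z := hv
    have hZ' : ∀ e, N.head e ∈ Z.erase v → N.tail e ∈ Z.erase v := fun e he =>
      Finset.mem_erase.2 ⟨fun h => hmax e h (Finset.mem_of_mem_erase he),
        hZ e (Finset.mem_of_mem_erase he)⟩
    have hpre : ∀ e, N.head e = v → N.tail e ∈ Z.erase v := fun e he =>
      Finset.mem_erase.2 ⟨fun h => N.head_ne_tail e (he.trans h.symm), hZ e (he ▸ hv)⟩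
    have h1 := ih (Z.erase v) hZ' (by rw [Finset.card_erase_of_mem hv, hn]; rfl)
    have h2 := mul_countReal_frontierIndep_le (F := F) T (S v) (R v) P hP hZ'
      (Finset.notMem_erase v Z) hpre (hST v) (hRT v) (hcover v) (hS v) (hR v)
    rw [Finset.insert_erase hv] at h2
    refine le_trans ?_ h2
    rw [← Finset.mul_prod_erase _ _ hv, mul_assoc]
    exact mul_le_mul_of_nonneg_left h1 (mul_nonneg (pow_nonneg (one_sub_singularProb_nonneg _ _) _)
      (sub_nonneg.2 (hR v)))

theorem failureProb_le_one_sub_prod [MeasurableSpace F] [MeasurableSingletonClass F]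
    [MeasurableSpace Ω] (μ : Measure Ω) [IsProbabilityMeasure μ] (T : Finset V)
    (k : N.AdjPair w → Ω → F) (hk_meas : ∀ p, Measurable (k p)) (hk_indep : iIndepFun k μ)
    (hk_unif : ∀ p c, μ.real (k p ⁻¹' {c}) = 1 / (Fintype.card F : ℝ))
    (P : V → Fin w → List E) (hP : ∀ t ∈ T, N.IsDisjointPaths t (P t)) (S R : V → Finset V)
    (hST : ∀ v, S v ⊆ T) (hRT : ∀ v, R v ⊆ T)
    (hcover : ∀ v, ∀ t ∈ T, t ∉ S v → t ∉ R v → ∀ j, ∀ e ∈ P t j, N.tail e ≠ v)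
    (hS : ∀ v, ∀ t ∈ S v, ∀ j, ∀ e ∈ P t j, N.tail e = v → N.head e = t)
    (hR : ∀ v, ((R v).card : ℝ) * singularProb (Fintype.card F) w ≤ 1) :
    N.failureProb w T μ k ≤ 1 - ∏ v, ((1 - singularProb (Fintype.card F) w) ^ (S v).card *
      (1 - (R v).card * singularProb (Fintype.card F) w)) := by
  classical
  have h1 := prod_mul_card_le_countReal_frontierIndep (F := F) T P hP S R hST hRT hcover hS hR
    Finset.univ (fun _ _ => Finset.mem_univ _)
  have hpos : (0 : ℝ) < Fintype.card (N.AdjPair w → F) := by exact_mod_cast Fintype.card_pos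
  have h2 : countReal (fun k : N.AdjPair w → F => ∃ t ∈ T, (N.decodingMatrix w k t).rank < w) ≤
      Fintype.card (N.AdjPair w → F) -
        countReal (fun k : N.AdjPair w → F => ∀ t ∈ T, N.FrontierIndep w Finset.univ (P t) k) := by
    rw [← countReal_not]
    refine countReal_mono fun k => ?_
    rintro ⟨t, ht, hlt⟩ hall
    exact absurd ((hall t ht).le_rank (hP t ht)) (not_le.2 hlt)
  rw [failureProb, measureReal_eq_countReal_div μ k hk_meas hk_indep hk_unif
    (fun k => ∃ t ∈ T, (N.decodingMatrix w k t).rank < w), div_le_iff₀ hpos]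
  linarith

end Network

/-! ### The failure bound -/

theorem theorem3 {V E F Ω : Type*} [Fintype V] [DecidableEq V] [Fintype E]
    [Field F] [Fintype F] [MeasurableSpace F] [MeasurableSingletonClass F]
    [MeasurableSpace Ω] (μ : Measure Ω) [IsProbabilityMeasure μ]
    (N : Network V E) (w : ℕ) (T : Finset V)
    -- the local encoding coefficients are independent and uniformly distributed
    (k : N.AdjPair w → Ω → F) (hk_meas : ∀ p, Measurable (k p)) (hk_indep : iIndepFun k μ)
    (hk_unif : ∀ p c, μ.real (k p ⁻¹' {c}) = 1 / (Fintype.card F : ℝ))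
    -- for each sink, `w` channel-disjoint paths from the source
    (P : V → Fin w → List E) (hP : ∀ t ∈ T, N.IsDisjointPaths t (P t))
    (n b u : ℕ) (hr : ∑ t ∈ T, N.numInternal t (P t) ≤ n)
    (hn : n = T.card * b + u) (hu : u < T.card)
    -- the base of the power is nonnegative whenever it occurs
    (hla : 0 < b → (T.card : ℝ) * singularProb (Fintype.card F) w ≤ 1) :
    N.failureProb w T μ k ≤
      1 - (1 - singularProb (Fintype.card F) w) ^ T.card
        * (1 - (T.card : ℝ) * singularProb (Fintype.card F) w) ^ b
        * (1 - (u : ℝ) * singularProb (Fintype.card F) w) := by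
  -- Without paths there is no last tail to choose; for `w = 0` both sides vanish.
  obtain rfl | hw := Nat.eq_zero_or_pos w
  · simp [Network.failureProb, singularProb]
  have ha := singularProb_nonneg (Fintype.card F) w
  have ha1 := one_sub_singularProb_nonneg (Fintype.card F) w
  choose! z hz hzlast using fun t (ht : t ∈ T) => (hP t ht).exists_last_tail hw
  set S : V → Finset V := fun v => {t ∈ T | z t = v} with hS
  set R : V → Finset V := fun v => {t ∈ T | v ∈ (N.pathTails (P t)).erase (z t)} with hR
  have hRle : ∀ v, (R v).card ≤ T.card := fun v => Finset.card_filter_le _ _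
  have hSsum : ∑ v, (S v).card = T.card :=
    (Finset.card_eq_sum_card_fiberwise (fun t _ => Finset.mem_univ (z t))).symm
  have hRsum : ∑ v, (R v).card ≤ n := by
    have hswap : ∑ v, (R v).card = ∑ t ∈ T, ((N.pathTails (P t)).erase (z t)).card := by
      simp only [hR, Finset.card_filter]
      rw [Finset.sum_comm]
      refine Finset.sum_congr rfl fun t _ => ?_
      rw [← Finset.card_filter, Finset.filter_mem_eq_inter, Finset.univ_inter]
    rw [hswap]
    refine (Finset.sum_le_sum fun t ht => ?_).trans hr
    -- Erasing `z t` cancels the `+ 1` in `card_pathTails_le`.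
    rw [Finset.card_erase_of_mem (hz t ht)]
    have := (hP t ht).card_pathTails_le
    omega
  have hbound : (∀ v, ((R v).card : ℝ) * singularProb (Fintype.card F) w ≤ 1) →
      N.failureProb w T μ k ≤ 1 - (1 - singularProb (Fintype.card F) w) ^ T.card *
        ∏ v, (1 - (R v).card * singularProb (Fintype.card F) w) := by
    intro hRa
    rw [← hSsum, ← Finset.prod_pow_eq_pow_sum, ← Finset.prod_mul_distrib]
    refine Network.failureProb_le_one_sub_prod μ T k hk_meas hk_indep hk_unif P hP S R
      (fun v => Finset.filter_subset _ _) (fun v => Finset.filter_subset _ _)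
      (fun v t ht htS htR j e he hev => ?_) (fun v t ht j e he hev => ?_) hRa
    · refine htR (Finset.mem_filter.2 ⟨ht, Finset.mem_erase.2 ⟨fun h => ?_, ?_⟩⟩)
      · exact htS (Finset.mem_filter.2 ⟨ht, h.symm⟩)
      · exact Network.mem_pathTails.2 ⟨j, e, he, hev⟩
    · obtain ⟨htT, rfl⟩ := Finset.mem_filter.1 ht
      exact hzlast t htT j e he hev
  -- If this product is negative the claimed bound is at least `1`, hence trivial. Its nonnegativity
  -- replaces the missing `l a ≤ 1` when `b = 0`, where it says `u a ≤ 1`.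
  suffices h : 0 ≤ (1 - (T.card : ℝ) * singularProb (Fintype.card F) w) ^ b
        * (1 - (u : ℝ) * singularProb (Fintype.card F) w) →
      (∀ v, ((R v).card : ℝ) * singularProb (Fintype.card F) w ≤ 1) ∧
      (1 - (T.card : ℝ) * singularProb (Fintype.card F) w) ^ b
        * (1 - (u : ℝ) * singularProb (Fintype.card F) w) ≤
      ∏ v, (1 - (R v).card * singularProb (Fintype.card F) w) by
    rw [mul_assoc]
    by_cases h0 : 0 ≤ (1 - (T.card : ℝ) * singularProb (Fintype.card F) w) ^ b
        * (1 - (u : ℝ) * singularProb (Fintype.card F) w)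
    · obtain ⟨h1, h2⟩ := h h0
      exact (hbound h1).trans (sub_le_sub_left
        (mul_le_mul_of_nonneg_left h2 (pow_nonneg ha1 _)) _)
    · have h1 : N.failureProb w T μ k ≤ 1 := measureReal_le_one
      have h2 := mul_nonpos_of_nonneg_of_nonpos (pow_nonneg ha1 T.card) (not_le.1 h0).le
      linarith
  intro h0
  obtain rfl | hb := Nat.eq_zero_or_pos b
  -- For `b = 0` one has `n = u`, so each `|R v|` is bounded by the whole sum, hence by `u`, and the
  -- elementary product inequality suffices.
  · have hsum : (∑ v, (R v).card : ℕ) * singularProb (Fintype.card F) w ≤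
        u * singularProb (Fintype.card F) w :=
      mul_le_mul_of_nonneg_right (by exact_mod_cast hRsum.trans (by omega)) ha
    rw [pow_zero, one_mul] at h0 ⊢
    refine ⟨fun v => ?_, ?_⟩
    · refine le_trans (mul_le_mul_of_nonneg_right ?_ ha) (hsum.trans (by linarith))
      exact_mod_cast Finset.single_le_sum (f := fun v => (R v).card) (fun _ _ => Nat.zero_le _)
        (Finset.mem_univ v)
    · exact le_trans (by linarith) (one_sub_sum_mul_le_prod ha Finset.univ _ (by linarith))
  · have hTpos : 0 < T.card := by omega
    refine ⟨fun v => le_trans (mul_le_mul_of_nonneg_right ?_ ha) (hla hb), ?_⟩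
    · exact_mod_cast hRle v
    · rw [← greedyProd_mul_add b hu, ← hn]
      exact (greedyProd_antitone hTpos ha (hla hb) hRsum).trans
        (greedyProd_sum_le_prod hTpos ha (hla hb) Finset.univ _ fun v _ => hRle v)
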